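/- Let $\mathfrak S_n$ be the set of permutations $\pi=\pi(1)\cdots\pi(n)$ of $\{1,\dots,n\}$. An alternating run of $\pi$ is a segment $\pi(i)\pi(i+1)\cdots\pi(j)$ with $i<j$ that is increasing or decreasing and is maximal with this property; let $\mathrm{run}(\pi)$ be the number of alternating runs of $\pi$. Let $\mathrm{as}(\pi)$ be the largest $k$ for which there are $i_1<\cdots<i_k$ with $\pi(i_1)>\pi(i_2)<\pi(i_3)>\cdots\pi(i_k)$. Define in $\mathbb Z[x]$ the type $A$ alternating run polynomials and the up-down run polynomials by $$R_n(x)=\sum_{\pi\in\mathfrak S_n}x^{\mathrm{run}(\pi)},\qquad S_n(x)=\sum_{\pi\in\mathfrak S_n}x^{\mathrm{as}(\pi)},$$ so that $R_1(x)=1$ and $S_0(x)=1$, and put $f_n(x)=(-1)^{n+1}(1-x^2)^{\lfloor n/2\rfloor}$ for $n\ge 0$ (so $f_0=-1$, $f_1=1$). A square matrix $(h_{ij})$ is lower Hessenberg if $h_{ij}=0$ whenever $j>i+1$. (a) For every $n\ge 0$, $S_{n+1}(x)=\det\,(a_{ij})_{0\le i,j\le n}$, where $(a_{ij})$ is the lower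 Hessenberg matrix of order $n+1$ with $a_{i0}=x\,S_i(x)$ and, for $j\ge1$, $a_{ij}=\binom{i}{j-1}f_{i-j+1}(x)$ if $j\le i+1$ and $a_{ij}=0$ if $j>i+1$: $$S_{n+1}(x)=\begin{vmatrix} x&-1&0&0&\cdots&0\\ xS_1(x)&f_1(x)&-\binom11&0&\cdots&0\\ xS_2(x)&f_2(x)&\binom21f_1(x)&-\binom22&\cdots&0\\ \vdots&\vdots&\vdots&\vdots&\ddots&\vdots\\ xS_{n-1}(x)&f_{n-1}(x)&\binom{n-1}1f_{n-2}(x)&\binom{n-1}2f_{n-3}(x)&\cdots&-\binom{n-1}{n-1}\\ xS_n(x)&f_n(x)&\binom n1f_{n-1}(x)&\binom n2f_{n-2}(x)&\cdots&\binom n{n-1}f_1(x) \end{vmatrix}.$$ (b) For every $n\ge 1$, $R_{n+1}(x)=\det\,(b_{ij})_{0\le i,j\le n-1}$, where $(b_{ij})$ is the lower Hessenberg matrix of order $n$ with $b_{i0}=2x\,R_{i+1}(x)$ and, for $j\ge1$, $b_{ij}=\binom{i}{j-1}f_{i-j+1}(x)$ if $j\le i+1$ and $b_{ij}=0$ if $j>i+1$: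 $$R_{n+1}(x)=\begin{vmatrix} 2x&-1&0&0&\cdots&0\\ 2xR_2(x)&f_1(x)&-\binom11&0&\cdots&0\\ 2xR_3(x)&f_2(x)&\binom21f_1(x)&-\binom22&\cdots&0\\ \vdots&\vdots&\vdots&\vdots&\ddots&\vdots\\ 2xR_{n-1}(x)&f_{n-2}(x)&\binom{n-2}1f_{n-3}(x)&\binom{n-2}2f_{n-4}(x)&\cdots&-\binom{n-2}{n-2}\\ 2xR_n(x)&f_{n-1}(x)&\binom{n-1}1f_{n-2}(x)&\binom{n-1}2f_{n-3}(x)&\cdots&\binom{n-1}{n-2}f_1(x) \end{vmatrix}.$$ -/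

import Mathlib

open scoped Polynomial

noncomputable section

namespace RunPoly

/-- The segment `w i, …, w j` (with `i < j`) of the word `w` is increasing or decreasing. -/
def IsMonotoneSegment {α : Type*} [LinearOrder α] {n : ℕ} (w : Fin n → α) (i j : Fin n) : Prop :=
  i < j ∧ (StrictMonoOn w (Set.Icc i j) ∨ StrictAntiOn w (Set.Icc i j))

/-- The segment `w i, …, w j` is an alternating run of `w`: a monotone segment that is not
properly contained in another one. -/
def IsRun {α : Type*} [LinearOrder α] {n : ℕ} (w : Fin n → α) (i j : Fin n) : Prop :=
  IsMonotoneSegment w i j ∧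
    ∀ i' j' : Fin n, i' ≤ i → j ≤ j' → IsMonotoneSegment w i' j' → i' = i ∧ j' = j

/-- The number of alternating runs of a word (it is `0` for a word of length at most `1`). -/
def run {α : Type*} [LinearOrder α] {n : ℕ} (w : Fin n → α) : ℕ :=
  Set.ncard {p : Fin n × Fin n | IsRun w p.1 p.2}

/-- The word `v 0, …, v (k - 1)` satisfies `v 0 > v 1 < v 2 > v 3 < …`. -/
def IsAlternating {α : Type*} [LinearOrder α] {k : ℕ} (v : Fin k → α) : Prop :=
  ∀ (t : ℕ) (ht : t + 1 < k),
    (Even t → v ⟨t + 1, ht⟩ < v ⟨t, Nat.lt_of_succ_lt ht⟩) ∧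
    (Odd t → v ⟨t, Nat.lt_of_succ_lt ht⟩ < v ⟨t + 1, ht⟩)

/-- The length of the longest alternating subsequence of a word of length `n`; the supremum is
that of a nonempty set of natural numbers, all at most `n`. -/
def longestAlt {α : Type*} [LinearOrder α] {n : ℕ} (w : Fin n → α) : ℕ :=
  sSup {k : ℕ | ∃ g : Fin k → Fin n, StrictMono g ∧ IsAlternating (w ∘ g)}

/-- The type A alternating run polynomial `R_n`. -/
def R (n : ℕ) : ℤ[X] :=
  ∑ π : Equiv.Perm (Fin n), Polynomial.X ^ run (π : Fin n → Fin n)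

/-- The up-down run polynomial `S_n`. -/
def S (n : ℕ) : ℤ[X] :=
  ∑ π : Equiv.Perm (Fin n), Polynomial.X ^ longestAlt (π : Fin n → Fin n)

/-- `f_n(x) = (-1)^(n+1) (1 - x^2)^⌊n/2⌋`. -/
def f (n : ℕ) : ℤ[X] :=
  (-1) ^ (n + 1) * (1 - Polynomial.X ^ 2) ^ (n / 2)

/-- A square matrix is lower Hessenberg if its entries above the superdiagonal vanish. -/
def IsLowerHessenberg {A : Type*} [Zero A] {m : ℕ} (M : Matrix (Fin m) (Fin m) A) : Prop :=
  ∀ i j : Fin m, (i : ℕ) + 1 < (j : ℕ) → M i j = 0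

/-- The `m × m` matrix, rows and columns numbered from `0`, with first column `c 0, c 1, …` and,
for `j ≥ 1`, with entry `binom(i, j - 1) f_(i - j + 1)` at `(i, j)` if `j ≤ i + 1` and `0` otherwise.
In particular, its superdiagonal entries are `-binom(i, i) = -1`. -/
def hessenbergMatrix (c : ℕ → ℤ[X]) (m : ℕ) : Matrix (Fin m) (Fin m) ℤ[X] :=
  Matrix.of fun i j =>
    if (j : ℕ) = 0 then c i
    else if (j : ℕ) ≤ (i : ℕ) + 1 then
      (Nat.choose (i : ℕ) ((j : ℕ) - 1) : ℤ[X]) * f ((i : ℕ) + 1 - (j : ℕ))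
    else 0

end RunPoly

end

namespace RunPoly

/-! Each determinant encodes a linear recurrence (`det_hessenbergMatrix`), so the task is to show
x·S_m + ∑ binom(m,k) f_{m-k} S_{k+1} = 0, and the same with 2x and R_{k+1} in place of x and S_k.

Splitting a word at its maximum or minimum gives binomial convolutions. Let T and U be the
exponential generating functions of words with sentinel steps at both ends, of equal and of opposite
directions (`oddRuns`, `evenRuns`), and s that of words with a sentinel at one end. Then T' = TU, U'
= T², s' = Ts. The longest alternating subsequence has length `runsFrom true`, so s is the series of
the S_n; splitting a word without sentinels shows that r = s² is that of the R_{n+1}.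

If F is the series of the f_n, the recurrences read F s' = -x s and F r' = -2x r, and both follow
from FT = -x (`egf_f_mul_egf`). -/

theorem hessenbergMatrix_isLowerHessenberg (c : ℕ → ℤ[X]) (m : ℕ) :
    IsLowerHessenberg (hessenbergMatrix c m) := by
  intro i j h
  have h0 : (j : ℕ) ≠ 0 := by omega
  have h1 : ¬ (j : ℕ) ≤ (i : ℕ) + 1 := by omega
  simp [hessenbergMatrix, h0, h1]

/-- The determinant of `hessenbergMatrix c m` is the `m`-th term of the sequence that solves the
linear recurrence read off from its rows. -/
theorem det_hessenbergMatrix (c d : ℕ → ℤ[X]) (h0 : d 0 = 1)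
    (hd : ∀ m, c m + ∑ k ∈ Finset.range (m + 1), (Nat.choose m k : ℤ[X]) * f (m - k) * d (k + 1) = 0)
    (m : ℕ) : (hessenbergMatrix c m).det = d m := by
  rcases m with _ | m
  · simp [h0]
  set H := hessenbergMatrix c (m + 1) with hH
  set v : Fin (m + 1) → ℤ[X] := fun j => d j with hv
  have hsum : ∀ i : Fin (m + 1), (H.mulVec v) i = c i + ∑ k ∈ Finset.range m,
      (if k ≤ (i : ℕ) then (Nat.choose i k : ℤ[X]) * f (i - k) * d (k + 1) else 0) := by
    intro i
    rw [Matrix.mulVec, dotProduct, Fin.sum_univ_succ]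
    congr 1
    · simp [hH, hv, hessenbergMatrix, h0]
    · rw [Finset.sum_range]
      refine Finset.sum_congr rfl fun k _ => ?_
      simp [hH, hv, hessenbergMatrix]
  have hf0 : f 0 = -1 := by simp [f]
  -- Row i < m of `H.mulVec v` is the full recurrence, hence zero. The last row lacks only the term
  -- k = m, which is f₀ d(m+1) = -d(m+1).
  have hHv : H.mulVec v = Pi.single (Fin.last m) (d (m + 1)) := by
    ext1 i
    rw [hsum]
    by_cases hi : i = Fin.last m
    · subst hi
      have := hd m
      rw [Finset.sum_range_succ] at this
      have hk : ∀ k ∈ Finset.range m, k ≤ ((Fin.last m : Fin (m + 1)) : ℕ) :=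
        fun k hk => (Finset.mem_range.mp hk).le
      rw [Pi.single_eq_same, Finset.sum_congr rfl fun k h => if_pos (hk k h)]
      simp only [Nat.choose_self, Nat.sub_self, hf0, Nat.cast_one, Fin.val_last] at this ⊢
      linear_combination this
    · have hlt : (i : ℕ) < m := Fin.val_lt_last hi
      rw [Pi.single_eq_of_ne hi, ← Finset.sum_filter, ← hd i]
      congr 1
      refine Finset.sum_congr ?_ fun _ _ => rfl
      ext k
      simp only [Finset.mem_filter, Finset.mem_range]
      omega
  -- Column 0 enters the combination with coefficient d 0 = 1, so the determinant is unchanged.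
  have hcol : (H.updateCol 0 (H.mulVec v)).det = H.det := by
    have h1 : H.mulVec v = fun i => ∑ j, v j • H i j := by
      ext1 i
      simp [Matrix.mulVec, dotProduct, mul_comm]
    rw [h1, Matrix.det_updateCol_sum]
    simp [hv, h0]
  rw [← hcol, hHv, Matrix.det_succ_column_zero, Finset.sum_eq_single (Fin.last m)]
  -- The surviving minor is triangular with diagonal entries f₀ = -1; its sign cancels that of the
  -- cofactor.
  · have hsub : ((H.updateCol 0 (Pi.single (Fin.last m) (d (m + 1)))).submatrix
        (Fin.last m).succAbove Fin.succ).det = (-1) ^ m := by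
      rw [Matrix.det_of_isLowerTriangular]
      · simp [hH, hessenbergMatrix, hf0]
      · intro i j hij
        have hij' : (i : ℕ) < j := hij
        simp [hH, hessenbergMatrix, Nat.choose_eq_zero_of_lt hij']
    rw [hsub]
    simp only [Matrix.updateCol_self, Pi.single_eq_same, Fin.val_last]
    rw [mul_right_comm, ← mul_pow]
    simp
  · intro i _ hi
    simp [hi]
  · simp

/-! ### Exponential generating functions and differential equations -/

/-- The binomial convolution of two sequences. -/
noncomputable def binomConv (P Q : ℕ → ℤ[X]) (n : ℕ) : ℤ[X] :=
  ∑ k ∈ Finset.range (n + 1), (Nat.choose n k : ℤ[X]) * P k * Q (n - k)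

theorem binomConv_comm (P Q : ℕ → ℤ[X]) (n : ℕ) : binomConv P Q n = binomConv Q P n := by
  rw [binomConv, ← Finset.sum_range_reflect]
  refine Finset.sum_congr rfl fun k hk => ?_
  have hk' : k ≤ n := by simpa [Nat.lt_succ_iff] using hk
  have h1 : n + 1 - 1 - k = n - k := by omega
  rw [h1, Nat.sub_sub_self hk', Nat.choose_symm hk']
  ring

/-- The exponential generating function of a sequence of integer polynomials. -/
noncomputable def egf (P : ℕ → ℤ[X]) : PowerSeries ℚ[X] :=
  PowerSeries.mk fun n => Polynomial.C (1 / (n.factorial : ℚ)) * (P n).map (Int.castRingHom ℚ)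

theorem egf_injective : Function.Injective egf := by
  intro P Q h
  funext n
  have h1 := congrArg (PowerSeries.coeff n) h
  simp only [egf, PowerSeries.coeff_mk] at h1
  have h2 : Polynomial.C (1 / (n.factorial : ℚ)) ≠ 0 := by
    simp [Nat.factorial_ne_zero]
  exact Polynomial.map_injective _ (Int.castRingHom ℚ).injective_int (mul_left_cancel₀ h2 h1)

theorem egf_binomConv (P Q : ℕ → ℤ[X]) : egf (binomConv P Q) = egf P * egf Q := by
  ext1 n
  rw [PowerSeries.coeff_mul, Finset.Nat.sum_antidiagonal_eq_sum_range_succ_mk]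
  simp only [egf, PowerSeries.coeff_mk, binomConv, Polynomial.map_sum, Finset.mul_sum]
  refine Finset.sum_congr rfl fun k hk => ?_
  have hk' : k ≤ n := by simpa [Nat.lt_succ_iff] using hk
  have hc : (1 / (n.factorial : ℚ)) * (n.choose k : ℚ)
      = (1 / (k.factorial : ℚ)) * (1 / ((n - k).factorial : ℚ)) := by
    rw [Nat.cast_choose ℚ hk']
    have := Nat.factorial_ne_zero n
    field_simp
  have hc' := congrArg (Polynomial.C (R := ℚ)) hc
  simp only [Polynomial.C_mul] at hc'
  simp only [Polynomial.map_mul, Polynomial.map_natCast]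
  rw [show ((n.choose k : ℕ) : ℚ[X]) = Polynomial.C (n.choose k : ℚ) by simp]
  linear_combination ((P k).map (Int.castRingHom ℚ)) * ((Q (n - k)).map (Int.castRingHom ℚ)) * hc'

theorem derivative_egf (P : ℕ → ℤ[X]) :
    PowerSeries.derivative ℚ[X] (egf P) = egf fun n => P (n + 1) := by
  ext1 n
  rw [PowerSeries.coeff_derivative]
  simp only [egf, PowerSeries.coeff_mk]
  have hc : (1 / ((n + 1).factorial : ℚ)) * ((n : ℚ) + 1) = 1 / (n.factorial : ℚ) := by
    rw [Nat.factorial_succ]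
    have := Nat.factorial_ne_zero n
    push_cast
    field_simp
  rw [← hc]
  simp only [Polynomial.C_mul, Polynomial.C_add, Polynomial.C_1,
    map_natCast]
  ring

theorem egf_const_mul (p : ℤ[X]) (P : ℕ → ℤ[X]) :
    egf (fun n => p * P n) = PowerSeries.C (p.map (Int.castRingHom ℚ)) * egf P := by
  ext1 n
  simp only [egf, PowerSeries.coeff_mk, PowerSeries.coeff_C_mul, Polynomial.map_mul]
  ring

theorem constantCoeff_egf (P : ℕ → ℤ[X]) :
    PowerSeries.constantCoeff (egf P) = (P 0).map (Int.castRingHom ℚ) := by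
  rw [← PowerSeries.coeff_zero_eq_constantCoeff_apply]
  simp [egf]

/-- A power series that solves a homogeneous linear differential equation of order one and
vanishes at the origin is zero. -/
theorem eq_zero_of_derivative_eq_mul {H U : PowerSeries ℚ[X]}
    (h : PowerSeries.derivative ℚ[X] H = U * H) (h0 : PowerSeries.constantCoeff H = 0) :
    H = 0 := by
  ext1 n
  induction n using Nat.strong_induction_on with
  | _ n ih =>
    rcases n with _ | n
    · simpa using h0
    -- Coefficient n of `U * H` involves only coefficients of `H` of index at most n, which vanish
    -- by induction.
    · have h1 := congrArg (PowerSeries.coeff n) h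
      rw [PowerSeries.coeff_derivative, PowerSeries.coeff_mul,
        Finset.sum_eq_zero] at h1
      · have h2 : ((n : ℚ[X]) + 1) ≠ 0 := by exact_mod_cast Nat.succ_ne_zero n
        simpa [h2] using h1
      · intro p hp
        have := Finset.HasAntidiagonal.mem_antidiagonal.mp hp
        rw [ih p.2 (by omega)]
        simp

theorem f_add_two (n : ℕ) : f (n + 2) = (1 - Polynomial.X ^ 2) * f n := by
  have : (n + 2) / 2 = n / 2 + 1 := by omega
  rw [f, f, this]
  ring

/-- The system has the first integral U² - T² = 1 - x², and F'' = (1 - x²)F. Hence H = F' + FU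
satisfies H' = UH with H(0) = 1 - 1 = 0, so H = 0 and (FT)' = TH = 0. -/
theorem egf_f_mul_egf {T U : ℕ → ℤ[X]} (hT0 : T 0 = Polynomial.X) (hU0 : U 0 = 1)
    (hT : ∀ n, T (n + 1) = binomConv T U n) (hU : ∀ n, U (n + 1) = binomConv T T n) : egf f * egf T = - PowerSeries.C (Polynomial.X : ℚ[X]) := by
  have dT : PowerSeries.derivative ℚ[X] (egf T) = egf T * egf U := by
    rw [derivative_egf, ← egf_binomConv]; exact congrArg egf (funext hT)
  have dU : PowerSeries.derivative ℚ[X] (egf U) = egf T * egf T := by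
    rw [derivative_egf, ← egf_binomConv]; exact congrArg egf (funext hU)
  set w : PowerSeries ℚ[X] := PowerSeries.C (1 - Polynomial.X ^ 2 : ℚ[X]) with hw
  have dw : PowerSeries.derivative ℚ[X] w = 0 := by
    rw [hw]; exact PowerSeries.derivative_C
  set F := egf f with hF
  set F' := PowerSeries.derivative ℚ[X] F with hF'
  have dF : PowerSeries.derivative ℚ[X] F' = w * F := by
    rw [hF', hF, derivative_egf, derivative_egf]
    have : (fun n => f (n + 1 + 1)) = fun n => (1 - Polynomial.X ^ 2) * f n := funext f_add_two
    rw [this, egf_const_mul]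
    simp [hw]
  have hE : egf U * egf U - egf T * egf T - w = 0 := by
    refine PowerSeries.derivative.ext ?_ ?_
    · simp only [map_sub, Derivation.leibniz, dT, dU, dw, smul_eq_mul, map_zero]
      ring
    · simp [constantCoeff_egf, hT0, hU0, hw]
      ring
  have hH : F' + F * egf U = 0 := by
    refine eq_zero_of_derivative_eq_mul (U := egf U) ?_ ?_
    · simp only [map_add, Derivation.leibniz, dF, dU, smul_eq_mul, ← hF']
      linear_combination (-F) * hE
    · simp [hF', hF, derivative_egf, constantCoeff_egf, hU0, f]
  refine PowerSeries.derivative.ext ?_ ?_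
  · rw [map_neg, PowerSeries.derivative_C]
    simp only [Derivation.leibniz, dT, smul_eq_mul, ← hF']
    linear_combination egf T * hH
  · simp [hF, constantCoeff_egf, hT0, f]

theorem f_recurrence_of_binomConv {T U s : ℕ → ℤ[X]} (hT0 : T 0 = Polynomial.X) (hU0 : U 0 = 1)
    (hT : ∀ n, T (n + 1) = binomConv T U n) (hU : ∀ n, U (n + 1) = binomConv T T n)
    (hs : ∀ n, s (n + 1) = binomConv T s n) (n : ℕ) :
    Polynomial.X * s n + binomConv (fun k => s (k + 1)) f n = 0 := by
  have hFT := egf_f_mul_egf hT0 hU0 hT hU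
  have ds : egf (fun k => s (k + 1)) = egf T * egf s := by
    rw [← egf_binomConv]; exact congrArg egf (funext hs)
  have h : egf (binomConv (fun k => s (k + 1)) f) = egf (fun n => (-Polynomial.X) * s n) := by
    rw [egf_binomConv, egf_const_mul, ds]
    simp only [Polynomial.map_neg, Polynomial.map_X, map_neg]
    linear_combination egf s * hFT
  rw [congrFun (egf_injective h) n]
  ring

/-- Since r = s², r' = 2ss' = 2Tr; this is the source of the factor 2. -/
theorem f_recurrence_of_binomConv_sq {T U s r : ℕ → ℤ[X]} (hT0 : T 0 = Polynomial.X) (hU0 : U 0 = 1)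
    (hT : ∀ n, T (n + 1) = binomConv T U n) (hU : ∀ n, U (n + 1) = binomConv T T n)
    (hs : ∀ n, s (n + 1) = binomConv T s n) (hr : ∀ n, r n = binomConv s s n)
    (n : ℕ) :
    2 * Polynomial.X * r n + binomConv (fun k => r (k + 1)) f n = 0 := by
  have hFT := egf_f_mul_egf hT0 hU0 hT hU
  have ds : PowerSeries.derivative ℚ[X] (egf s) = egf T * egf s := by
    rw [derivative_egf, ← egf_binomConv]; exact congrArg egf (funext hs)
  have er : egf r = egf s * egf s := by
    rw [← egf_binomConv]; exact congrArg egf (funext hr)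
  have h : egf (binomConv (fun k => r (k + 1)) f) = egf (fun n => (-(2 * Polynomial.X)) * r n) := by
    rw [egf_binomConv, egf_const_mul, ← derivative_egf, er]
    simp only [Derivation.leibniz, ds, smul_eq_mul]
    simp only [Polynomial.map_neg, Polynomial.map_mul, Polynomial.map_X, map_neg, map_mul,
      Polynomial.map_ofNat, map_ofNat]
    linear_combination 2 * egf s * egf s * hFT
  rw [congrFun (egf_injective h) n]
  ring

/-! ### Run statistics of words and their splitting at an extremal letter -/

section Words

variable {α : Type*} [LinearOrder α]

/-- The word of ascents (`true`) and descents (`false`) of a word. -/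
def ascents : List α → List Bool
  | [] => []
  | [_] => []
  | a :: b :: l => decide (a < b) :: ascents (b :: l)

/-- The number of pairs of consecutive distinct letters of a binary word. -/
def changes : List Bool → ℕ
  | [] => 0
  | [_] => 0
  | a :: b :: l => (if a = b then 0 else 1) + changes (b :: l)

theorem changes_append_cons_cons (L M : List Bool) (a b : Bool) :
    changes (L ++ a :: b :: M) =
      changes (L ++ [a]) + (if a = b then 0 else 1) + changes (b :: M) := by
  induction L with
  | nil => simp [changes]
  | cons c L ih =>
    rcases L with _ | ⟨d, L⟩
    · simp only [List.cons_append, List.nil_append, changes]; omega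
    · simp only [List.cons_append, changes] at ih ⊢
      omega

/-- Next to the letter `m`, any letter of `l` leads up to `m` if `s` is true,
and down to `m` otherwise. -/
def IsExtremal (s : Bool) (m : α) (l : List α) : Prop :=
  ∀ a ∈ l, decide (a < m) = s ∧ decide (m < a) = !s

theorem ascents_append_cons {s : Bool} {m : α} {u : List α} (hu : IsExtremal s m u) (h : u ≠ [])
    (v : List α) : ascents (u ++ m :: v) = ascents u ++ s :: ascents (m :: v) := by
  induction u with
  | nil => exact absurd rfl h
  | cons a u ih =>
    rcases u with _ | ⟨b, u⟩
    · simp only [List.cons_append, List.nil_append, ascents, (hu a (by simp)).1]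
    · have := ih (fun c hc => hu c (List.mem_cons_of_mem _ hc)) (by simp)
      simp only [List.cons_append, ascents] at this ⊢
      rw [this]

theorem ascents_cons {s : Bool} {m : α} {v : List α} (hv : IsExtremal s m v) (h : v ≠ []) :
    ascents (m :: v) = (!s) :: ascents v := by
  rcases v with _ | ⟨b, v⟩
  · exact absurd rfl h
  · simp only [ascents, (hv b (by simp)).2]

/-- The number of runs of the word extended by sentinels at both ends, such that the first
step and the last step have direction `s`. -/
def oddRuns (s : Bool) (l : List α) : ℕ := changes (s :: (ascents l ++ [s])) + 1

/-- The number of runs of the word extended by sentinels at both ends, such that the first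
step has direction `!s` and the last one has direction `s`; by convention, `0` for the empty word. -/
def evenRuns (s : Bool) (l : List α) : ℕ :=
  if l = [] then 0 else changes ((!s) :: (ascents l ++ [s])) + 1

/-- The number of runs of a nonempty word preceded by a step in direction `s`. -/
def runsFrom (s : Bool) (l : List α) : ℕ :=
  if l = [] then 0 else changes (s :: ascents l) + 1

/-- The number of runs of a nonempty word followed by a step in direction `s`. -/
def runsTo (s : Bool) (l : List α) : ℕ :=
  if l = [] then 0 else changes (ascents l ++ [s]) + 1

/-- The number of runs of a word. -/
def runs (l : List α) : ℕ :=
  if ascents l = [] then 0 else changes (ascents l) + 1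

variable {s : Bool} {m : α} {u v : List α}

theorem changes_cons_append_cons_cons (c : Bool) (L M : List Bool) (a b : Bool) :
    changes (c :: (L ++ a :: b :: M)) =
      changes (c :: (L ++ [a])) + (if a = b then 0 else 1) + changes (b :: M) :=
  changes_append_cons_cons (c :: L) M a b

/-- The word enters m by a step s and leaves it by `!s`, so m acts as a sentinel for both halves,
and runs are cut exactly at m. If v is empty, the final sentinel step prolongs the run ending at m;
the value 0 of `evenRuns` at `[]` accounts for this. The next four lemmas work alike. -/
theorem oddRuns_append_cons (hu : IsExtremal s m u) (hv : IsExtremal s m v) :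
    oddRuns s (u ++ m :: v) = oddRuns s u + evenRuns s v := by
  by_cases hu0 : u = [] <;> by_cases hv0 : v = [] <;>
    simp [oddRuns, evenRuns, hu0, hv0, ascents_append_cons hu, ascents_cons hv, ascents, changes,
      changes_cons_append_cons_cons] <;> omega

theorem evenRuns_append_cons (hu : IsExtremal (!s) m u) (hv : IsExtremal (!s) m v) :
    evenRuns s (u ++ m :: v) = oddRuns (!s) u + oddRuns s v := by
  by_cases hu0 : u = [] <;> by_cases hv0 : v = [] <;>
    simp [oddRuns, evenRuns, hu0, hv0, ascents_append_cons hu, ascents_cons hv, ascents, changes,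
      changes_cons_append_cons_cons] <;> omega

theorem runsFrom_append_cons (hu : IsExtremal s m u) (hv : IsExtremal s m v) :
    runsFrom s (u ++ m :: v) = oddRuns s u + runsFrom (!s) v := by
  by_cases hu0 : u = [] <;> by_cases hv0 : v = [] <;>
    simp [oddRuns, runsFrom, hu0, hv0, ascents_append_cons hu, ascents_cons hv, ascents, changes,
      changes_cons_append_cons_cons] <;> omega

theorem runsTo_append_cons (hu : IsExtremal (!s) m u) (hv : IsExtremal (!s) m v) :
    runsTo s (u ++ m :: v) = runsTo (!s) u + oddRuns s v := by
  by_cases hu0 : u = [] <;> by_cases hv0 : v = [] <;>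
    simp [oddRuns, runsTo, hu0, hv0, ascents_append_cons hu, ascents_cons hv, ascents, changes,
      changes_append_cons_cons]
  omega

theorem runs_append_cons (hu : IsExtremal s m u) (hv : IsExtremal s m v) :
    runs (u ++ m :: v) = runsTo s u + runsFrom (!s) v := by
  by_cases hu0 : u = [] <;> by_cases hv0 : v = [] <;>
    simp [runs, runsTo, runsFrom, hu0, hv0, ascents_append_cons hu, ascents_cons hv, ascents,
      changes_append_cons_cons]
  omega

/-! ### Words on a finite alphabet and binomial convolution -/

/-- The words that contain each element of `A` exactly once, and no other letter. -/
def words (A : Finset α) : Finset (List α) := A.val.lists.toFinset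

theorem mem_words {A : Finset α} {l : List α} : l ∈ words A ↔ l.Nodup ∧ l.toFinset = A := by
  rw [words, Multiset.mem_toFinset, Multiset.mem_lists_iff]
  constructor
  · intro h
    have h' : A.val = (l : Multiset α) := h
    refine ⟨?_, ?_⟩
    · rw [← Multiset.coe_nodup, ← h']; exact A.nodup
    · ext a
      rw [List.mem_toFinset, ← Multiset.mem_coe, ← h', Finset.mem_val]
  · rintro ⟨h1, rfl⟩
    rw [List.toFinset_val, h1.dedup]
    rfl

theorem words_empty : words (∅ : Finset α) = {[]} := by
  ext l
  rw [mem_words, Finset.mem_singleton, List.toFinset_eq_empty_iff]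
  constructor
  · exact fun h => h.2
  · rintro rfl; simp

theorem sum_words_eq_sum_powerset {M : Type*} [AddCommMonoid M] {A : Finset α} (hm : m ∈ A)
    (φ : List α → M) :
    ∑ l ∈ words A, φ l = ∑ B ∈ (A.erase m).powerset,
      ∑ u ∈ words B, ∑ v ∈ words (A.erase m \ B), φ (u ++ m :: v) := by
  simp_rw [← Finset.sum_product']
  rw [Finset.sum_sigma']
  symm
  refine Finset.sum_bij (fun p _ => p.2.1 ++ m :: p.2.2) ?_ ?_ ?_ ?_
  · rintro ⟨B, u, v⟩ h
    simp only [Finset.mem_sigma, Finset.mem_powerset, Finset.mem_product, mem_words] at h ⊢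
    obtain ⟨hB, ⟨hu, rfl⟩, hv, hv'⟩ := h
    have hv'' : ∀ a, a ∈ v ↔ (a ≠ m ∧ a ∈ A) ∧ a ∉ u := by
      intro a
      rw [← List.mem_toFinset, hv']
      simp
    have hu'' : ∀ a ∈ u, a ≠ m ∧ a ∈ A := by
      intro a ha
      simpa using hB (List.mem_toFinset.mpr ha)
    constructor
    · rw [List.nodup_append]
      refine ⟨hu, List.nodup_cons.mpr ⟨fun h => ((hv'' m).mp h).1.1 rfl, hv⟩, ?_⟩
      rintro a ha b hb rfl
      rcases List.mem_cons.mp hb with rfl | hb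
      · exact (hu'' _ ha).1 rfl
      · exact ((hv'' _).mp hb).2 ha
    · ext a
      simp only [List.mem_toFinset, List.mem_append, List.mem_cons, hv'']
      constructor
      · rintro (h | rfl | h)
        exacts [(hu'' a h).2, hm, h.1.2]
      · intro h
        by_cases h1 : a ∈ u <;> by_cases h2 : a = m <;> simp [h, h1, h2]
  · rintro ⟨B, u, v⟩ h ⟨B', u', v'⟩ h' he
    simp only [Finset.mem_sigma, Finset.mem_powerset, Finset.mem_product, mem_words] at h h'
    obtain ⟨hB, ⟨hu, rfl⟩, hv, hv'⟩ := h
    obtain ⟨hB', ⟨hu', rfl⟩, hw, hw'⟩ := h'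
    have h1 : m ∉ u := fun h => by simpa using hB (List.mem_toFinset.mpr h)
    have h2 : m ∉ u' := fun h => by simpa using hB' (List.mem_toFinset.mpr h)
    have h3 : m ∉ v := fun h => by simpa [hv'] using List.mem_toFinset.mpr h
    have h4 : m ∉ v' := fun h => by simpa [hw'] using List.mem_toFinset.mpr h
    dsimp only at he
    -- A nonempty overlap between the two factorizations would put m into u or u'.
    obtain ⟨rfl, rfl⟩ : u = u' ∧ v = v' := by
      rcases List.append_eq_append_iff.mp he with ⟨c, hc, hd⟩ | ⟨c, hc, hd⟩ <;>
        rcases c with _ | ⟨x, c⟩ <;> simp_all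
    rfl
  · intro l hl
    rw [mem_words] at hl
    obtain ⟨hl, rfl⟩ := hl
    obtain ⟨u, v, rfl⟩ := List.append_of_mem (List.mem_toFinset.mp hm)
    rw [List.nodup_append, List.nodup_cons] at hl
    obtain ⟨hu, ⟨hmv, hv⟩, hd⟩ := hl
    refine ⟨⟨u.toFinset, u, v⟩, ?_, rfl⟩
    rw [Finset.mem_sigma, Finset.mem_powerset, Finset.mem_product, mem_words, mem_words]
    refine ⟨?_, ⟨hu, rfl⟩, hv, ?_⟩
    · intro a ha
      have ha' := List.mem_toFinset.mp ha
      have : a ≠ m := hd a ha' m (by simp)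
      simp [this, ha']
    · ext a
      simp only [Finset.mem_sdiff, Finset.mem_erase, List.mem_toFinset, List.mem_append,
        List.mem_cons]
      constructor
      · intro h
        exact ⟨⟨fun e => hmv (e ▸ h), Or.inr (Or.inr h)⟩, fun h' => hd a h' a (by simp [h]) rfl⟩
      · rintro ⟨⟨h1, h2⟩, h3⟩
        tauto
  · intro _ _
    rfl

/-- If a statistic on words is additive along the splitting of a word at the letter `m`, then
its distribution is a binomial convolution. -/
theorem sum_words_eq_binomConv {A : Finset α} (hm : m ∈ A) {n : ℕ} (hA : A.card = n + 1)
    {φ φ₁ φ₂ : List α → ℕ} {P Q : ℕ → ℤ[X]}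
    (hP : ∀ B : Finset α, B.card ≤ n → ∑ l ∈ words B, (Polynomial.X : ℤ[X]) ^ φ₁ l = P B.card)
    (hQ : ∀ B : Finset α, B.card ≤ n → ∑ l ∈ words B, (Polynomial.X : ℤ[X]) ^ φ₂ l = Q B.card)
    (hφ : ∀ u v, (∀ a ∈ u, a ∈ A.erase m) → (∀ a ∈ v, a ∈ A.erase m) →
      φ (u ++ m :: v) = φ₁ u + φ₂ v) :
    ∑ l ∈ words A, (Polynomial.X : ℤ[X]) ^ φ l = binomConv P Q n := by
  have hc : (A.erase m).card = n := by rw [Finset.card_erase_of_mem hm, hA]; rfl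
  rw [sum_words_eq_sum_powerset hm]
  have h1 : ∀ B ∈ (A.erase m).powerset, ∑ u ∈ words B, ∑ v ∈ words (A.erase m \ B),
      (Polynomial.X : ℤ[X]) ^ φ (u ++ m :: v) = P B.card * Q (n - B.card) := by
    intro B hB
    rw [Finset.mem_powerset] at hB
    have hB' : (A.erase m \ B).card = n - B.card := by rw [Finset.card_sdiff_of_subset hB, hc]
    rw [← hP B (hc ▸ Finset.card_le_card hB), ← hB', ← hQ _ (by omega), Finset.sum_mul_sum]
    refine Finset.sum_congr rfl fun u hu => Finset.sum_congr rfl fun v hv => ?_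
    rw [hφ, pow_add]
    · intro a ha
      rw [mem_words] at hu
      exact hB (hu.2 ▸ List.mem_toFinset.mpr ha)
    · intro a ha
      rw [mem_words] at hv
      exact Finset.sdiff_subset (hv.2 ▸ List.mem_toFinset.mpr ha)
  -- The summand depends only on the size of B, and binom(n,k) sets B have size k.
  rw [Finset.sum_congr rfl h1, Finset.sum_powerset_apply_card (fun k => P k * Q (n - k)), hc]
  simp [binomConv, nsmul_eq_mul, mul_assoc]

theorem exists_isExtremal (s : Bool) {A : Finset α} (hA : A.Nonempty) :
    ∃ m ∈ A, ∀ l : List α, (∀ a ∈ l, a ∈ A.erase m) → IsExtremal s m l := by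
  cases s
  · refine ⟨A.min' hA, A.min'_mem hA, fun l hl a ha => ?_⟩
    have h := Finset.min'_lt_of_mem_erase_min' A hA (hl a ha)
    exact ⟨decide_eq_false h.not_gt, decide_eq_true h⟩
  · refine ⟨A.max' hA, A.max'_mem hA, fun l hl a ha => ?_⟩
    have h := Finset.lt_max'_of_mem_erase_max' A hA (hl a ha)
    exact ⟨decide_eq_true h, decide_eq_false h.not_gt⟩

end Words

/-! ### The distribution polynomials -/

/-- The distributions of `oddRuns` and `evenRuns` on words of length `n`. -/
noncomputable def oddEvenPoly : ℕ → ℤ[X] × ℤ[X]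
  | 0 => (Polynomial.X, 1)
  | n + 1 =>
    -- Indexing by `Fin` supplies the bound k < n + 1 that termination needs.
    (∑ k : Fin (n + 1), (Nat.choose n k : ℤ[X]) * (oddEvenPoly k).1 * (oddEvenPoly (n - k)).2,
     ∑ k : Fin (n + 1), (Nat.choose n k : ℤ[X]) * (oddEvenPoly k).1 * (oddEvenPoly (n - k)).1)

/-- The distribution of `oddRuns` on words of length `n`. -/
noncomputable def oddPoly (n : ℕ) : ℤ[X] := (oddEvenPoly n).1

/-- The distribution of `evenRuns` on words of length `n`. -/
noncomputable def evenPoly (n : ℕ) : ℤ[X] := (oddEvenPoly n).2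

/-- The distribution of `runsFrom` and of `runsTo` on words of length `n`. -/
noncomputable def fromPoly : ℕ → ℤ[X]
  | 0 => 1
  | n + 1 => ∑ k : Fin (n + 1), (Nat.choose n k : ℤ[X]) * oddPoly k * fromPoly (n - k)

theorem oddPoly_zero : oddPoly 0 = Polynomial.X := by rw [oddPoly, oddEvenPoly]

theorem evenPoly_zero : evenPoly 0 = 1 := by rw [evenPoly, oddEvenPoly]

theorem fromPoly_zero : fromPoly 0 = 1 := by rw [fromPoly]

theorem oddPoly_succ (n : ℕ) : oddPoly (n + 1) = binomConv oddPoly evenPoly n := by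
  rw [oddPoly, oddEvenPoly, binomConv, Finset.sum_range]; rfl

theorem evenPoly_succ (n : ℕ) : evenPoly (n + 1) = binomConv oddPoly oddPoly n := by
  rw [evenPoly, oddEvenPoly, binomConv, Finset.sum_range]; rfl

theorem fromPoly_succ (n : ℕ) : fromPoly (n + 1) = binomConv oddPoly fromPoly n := by
  rw [fromPoly, binomConv, Finset.sum_range]

section Distributions

variable {α : Type*} [LinearOrder α]

theorem sum_words_oddRuns_evenRuns (A : Finset α) :
    ∀ s, ∑ l ∈ words A, (Polynomial.X : ℤ[X]) ^ oddRuns s l = oddPoly A.card ∧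
      ∑ l ∈ words A, (Polynomial.X : ℤ[X]) ^ evenRuns s l = evenPoly A.card := by
  obtain ⟨n, hn⟩ : ∃ n, A.card = n := ⟨_, rfl⟩
  induction n using Nat.strong_induction_on generalizing A with
  | _ n ih =>
    intro s
    rcases n with _ | n
    · rw [hn, Finset.card_eq_zero.mp hn, words_empty]
      simp [oddPoly_zero, evenPoly_zero, oddRuns, evenRuns, ascents, changes]
    · have hA : A.Nonempty := Finset.card_pos.mp (by omega)
      rw [hn, oddPoly_succ, evenPoly_succ]
      constructor
      · obtain ⟨m, hm, h⟩ := exists_isExtremal s hA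
        exact sum_words_eq_binomConv hm hn
          (fun B hB => (ih _ (Nat.lt_succ_of_le hB) B rfl s).1)
          (fun B hB => (ih _ (Nat.lt_succ_of_le hB) B rfl s).2)
          (fun u v hu hv => oddRuns_append_cons (h u hu) (h v hv))
      · obtain ⟨m, hm, h⟩ := exists_isExtremal (!s) hA
        exact sum_words_eq_binomConv hm hn
          (fun B hB => (ih _ (Nat.lt_succ_of_le hB) B rfl (!s)).1)
          (fun B hB => (ih _ (Nat.lt_succ_of_le hB) B rfl s).1)
          (fun u v hu hv => evenRuns_append_cons (h u hu) (h v hv))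

theorem sum_words_runsFrom (s : Bool) (A : Finset α) :
    ∑ l ∈ words A, (Polynomial.X : ℤ[X]) ^ runsFrom s l = fromPoly A.card := by
  obtain ⟨n, hn⟩ : ∃ n, A.card = n := ⟨_, rfl⟩
  induction n using Nat.strong_induction_on generalizing A s with
  | _ n ih =>
    rcases n with _ | n
    · rw [hn, Finset.card_eq_zero.mp hn, words_empty]
      simp [fromPoly_zero, runsFrom]
    · obtain ⟨m, hm, h⟩ := exists_isExtremal s (Finset.card_pos.mp (by omega) : A.Nonempty)
      rw [hn, fromPoly_succ]
      exact sum_words_eq_binomConv hm hn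
        (fun B _ => (sum_words_oddRuns_evenRuns B s).1)
        (fun B hB => ih _ (Nat.lt_succ_of_le hB) (!s) B rfl)
        (fun u v hu hv => runsFrom_append_cons (h u hu) (h v hv))

theorem sum_words_runsTo (s : Bool) (A : Finset α) :
    ∑ l ∈ words A, (Polynomial.X : ℤ[X]) ^ runsTo s l = fromPoly A.card := by
  obtain ⟨n, hn⟩ : ∃ n, A.card = n := ⟨_, rfl⟩
  induction n using Nat.strong_induction_on generalizing A s with
  | _ n ih =>
    rcases n with _ | n
    · rw [hn, Finset.card_eq_zero.mp hn, words_empty]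
      simp [fromPoly_zero, runsTo]
    · obtain ⟨m, hm, h⟩ := exists_isExtremal (!s) (Finset.card_pos.mp (by omega) : A.Nonempty)
      rw [hn, fromPoly_succ, binomConv_comm]
      exact sum_words_eq_binomConv hm hn
        (fun B hB => ih _ (Nat.lt_succ_of_le hB) (!s) B rfl)
        (fun B _ => (sum_words_oddRuns_evenRuns B s).1)
        (fun u v hu hv => runsTo_append_cons (h u hu) (h v hv))

theorem sum_words_runs {n : ℕ} (A : Finset α) (hA : A.card = n + 1) :
    ∑ l ∈ words A, (Polynomial.X : ℤ[X]) ^ runs l = binomConv fromPoly fromPoly n := by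
  obtain ⟨m, hm, h⟩ := exists_isExtremal true (Finset.card_pos.mp (by omega) : A.Nonempty)
  exact sum_words_eq_binomConv hm hA (fun B _ => sum_words_runsTo true B)
    (fun B _ => sum_words_runsFrom (!true) B)
    (fun u v hu hv => runs_append_cons (h u hu) (h v hv))

end Distributions

theorem sum_perm_eq_sum_words (n : ℕ) (φ : List (Fin n) → ℤ[X]) :
    ∑ π : Equiv.Perm (Fin n), φ (List.ofFn π) = ∑ l ∈ words (Finset.univ : Finset (Fin n)), φ l := by
  refine Finset.sum_bij (fun π _ => List.ofFn π) ?_ ?_ ?_ fun _ _ => rfl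
  · intro π _
    rw [mem_words]
    refine ⟨List.nodup_ofFn.mpr π.injective, ?_⟩
    ext a
    simp only [List.mem_toFinset, List.mem_ofFn, Finset.mem_univ, iff_true]
    exact π.surjective a
  · intro π _ σ _ h
    exact Equiv.coe_fn_injective (List.ofFn_injective h)
  · intro l hl
    obtain ⟨h1, h2⟩ := mem_words.mp hl
    have hlen : l.length = n := by
      rw [← List.toFinset_card_of_nodup h1, h2, Finset.card_univ, Fintype.card_fin]
    have hinj : Function.Injective fun i : Fin n => l.get (i.cast hlen.symm) :=
      h1.injective_get.comp (Fin.cast_injective _)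
    refine ⟨Equiv.ofBijective _ (Finite.injective_iff_bijective.mp hinj), Finset.mem_univ _, ?_⟩
    exact List.ext_getElem (by simp [hlen]) fun i _ _ => by simp

/-! ### Longest alternating subsequences -/

section LongestAlternating

variable {α : Type*} [LinearOrder α]

/-- The steps of the word alternate, the first one having direction `s`. -/
def StepsAlternate : Bool → List α → Prop
  | _, [] => True
  | _, [_] => True
  | s, a :: b :: l => decide (a < b) = s ∧ StepsAlternate (!s) (b :: l)

theorem changes_cons_le (s : Bool) (L : List Bool) : changes (s :: L) ≤ 1 + changes ((!s) :: L) := by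
  rcases L with _ | ⟨a, L⟩
  · simp [changes]
  · cases s <;> cases a <;> simp [changes] <;> omega

theorem runsFrom_singleton (s : Bool) (a : α) : runsFrom s [a] = 1 := by
  simp [runsFrom, ascents, changes]

theorem runsFrom_cons_cons_same {s : Bool} {a b : α} (h : decide (a < b) = s) (l : List α) :
    runsFrom s (a :: b :: l) = runsFrom s (b :: l) := by
  simp [runsFrom, ascents, changes, h]

theorem runsFrom_cons_cons_opposite {s : Bool} {a b : α} (h : decide (a < b) = !s) (l : List α) :
    runsFrom s (a :: b :: l) = 1 + runsFrom (!s) (b :: l) := by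
  simp [runsFrom, ascents, changes, h]
  omega

theorem one_le_runsFrom_cons (s : Bool) (a : α) (l : List α) : 1 ≤ runsFrom s (a :: l) := by
  simp [runsFrom]

theorem runsFrom_le (s : Bool) (l : List α) : runsFrom s l ≤ 1 + runsFrom (!s) l := by
  have := changes_cons_le s (ascents l)
  simp only [runsFrom]
  split <;> omega

theorem length_le_runsFrom {s : Bool} {l v : List α} (hvl : v.Sublist l)
    (hv : StepsAlternate (!s) v) : v.length ≤ runsFrom s l := by
  induction l generalizing s v with
  | nil => simp [List.sublist_nil.mp hvl]
  | cons a l ih =>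
    rcases l with _ | ⟨b, l⟩
    · rw [runsFrom_singleton]
      exact hvl.length_le
    by_cases h : decide (a < b) = s
    · rw [runsFrom_cons_cons_same h]
      rcases List.sublist_cons_iff.mp hvl with h1 | ⟨v, rfl, h1⟩
      · exact ih h1 hv
      · rcases v with _ | ⟨c, v⟩
        · exact one_le_runsFrom_cons s b l
        · have hac : decide (a < c) = !s := hv.1
          -- Exchange: b lies beyond a in direction s, so b can replace a as first letter. The case
          -- c = b is impossible, as the step from a to c has direction `!s`.
          rcases List.sublist_cons_iff.mp h1 with h2 | ⟨v', he, h2⟩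
          · have hbc : decide (b < c) = !s := by
              cases s <;> simp at h hac ⊢
              · exact h.trans_lt hac
              · exact hac.trans h.le
            exact ih (v := b :: c :: v) (h2.cons_cons b) ⟨hbc, hv.2⟩
          · obtain ⟨rfl, rfl⟩ := List.cons.inj he
            rw [h] at hac
            cases s <;> simp at hac
    · have h' : decide (a < b) = !s := by cases s <;> simpa using h
      rw [runsFrom_cons_cons_opposite h']
      rcases List.sublist_cons_iff.mp hvl with h1 | ⟨v, rfl, h1⟩
      · exact (ih h1 hv).trans (runsFrom_le s _)
      · have hv' : StepsAlternate (!(!s)) v := by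
          rcases v with _ | ⟨c, v⟩
          · trivial
          · exact hv.2
        have := ih h1 hv'
        rw [List.length_cons]
        omega

/-- The last clause strengthens the induction: it guarantees that a letter before a, from which a
lies in direction s, can be prepended to the subsequence. -/
theorem exists_sublist_length_eq_runsFrom (s : Bool) (a : α) (l : List α) :
    ∃ c v, (c :: v).Sublist (a :: l) ∧ StepsAlternate (!s) (c :: v) ∧
      (c :: v).length = runsFrom s (a :: l) ∧ (c = a ∨ decide (a < c) = s) := by
  induction l generalizing s a with
  | nil => exact ⟨a, [], List.Sublist.refl _, trivial, by simp [runsFrom_singleton], Or.inl rfl⟩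
  | cons b l ih =>
    by_cases h : decide (a < b) = s
    · obtain ⟨c, v, h1, h2, h3, h4⟩ := ih s b
      refine ⟨c, v, h1.cons a, h2, h3.trans (runsFrom_cons_cons_same h l).symm, Or.inr ?_⟩
      rcases h4 with rfl | h4
      · exact h
      · cases s <;> simp at h h4 ⊢
        · exact h4.trans h
        · exact h.trans h4
    · have h' : decide (a < b) = !s := by cases s <;> simpa using h
      obtain ⟨c, v, h1, h2, h3, h4⟩ := ih (!s) b
      refine ⟨a, c :: v, h1.cons_cons a, ⟨?_, h2⟩, ?_, Or.inl rfl⟩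
      · rcases h4 with rfl | h4
        · exact h'
        · cases s <;> simp at h' h4 ⊢
          · exact h'.trans h4
          · exact h4.trans h'
      · rw [List.length_cons, h3, runsFrom_cons_cons_opposite h', add_comm]

theorem exists_sublist_stepsAlternate (s : Bool) (l : List α) :
    ∃ v : List α, v.Sublist l ∧ StepsAlternate (!s) v ∧ v.length = runsFrom s l := by
  rcases l with _ | ⟨a, l⟩
  · exact ⟨[], List.Sublist.refl _, trivial, by simp [runsFrom]⟩
  · obtain ⟨c, v, h1, h2, h3, -⟩ := exists_sublist_length_eq_runsFrom s a l
    exact ⟨c :: v, h1, h2, h3⟩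

theorem stepsAlternate_iff {s : Bool} {v : List α} :
    StepsAlternate s v ↔ ∀ (t : ℕ) (ht : t + 1 < v.length),
      decide (v[t] < v[t + 1]) = if Even t then s else !s := by
  induction v generalizing s with
  | nil => simp [StepsAlternate]
  | cons a v ih =>
    rcases v with _ | ⟨b, v⟩
    · simp [StepsAlternate]
    · rw [StepsAlternate, ih]
      constructor
      · rintro ⟨h1, h2⟩ t ht
        rcases t with _ | t
        · simpa using h1
        · have := h2 t (by simpa using ht)
          refine Eq.trans this ?_
          simp only [Nat.even_add_one]
          by_cases ht : Even t <;> simp [ht]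
      · intro h
        refine ⟨by simpa using h 0 (by simp), fun t ht => ?_⟩
        have := h (t + 1) (by simpa using ht)
        simp only [List.getElem_cons_succ, Nat.even_add_one] at this ⊢
        rw [this]
        by_cases ht : Even t <;> simp [ht]

theorem isAlternating_iff {k : ℕ} {v : Fin k → α} (hv : Function.Injective v) :
    IsAlternating v ↔ StepsAlternate false (List.ofFn v) := by
  rw [stepsAlternate_iff, IsAlternating]
  simp only [List.length_ofFn, List.getElem_ofFn]
  refine forall₂_congr fun t ht => ?_
  have hne : v ⟨t, Nat.lt_of_succ_lt ht⟩ ≠ v ⟨t + 1, ht⟩ := fun h => by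
    simpa using hv h
  by_cases h : Even t
  · have h' : ¬ Odd t := Nat.not_odd_iff_even.mpr h
    simp only [h, h', forall_const, IsEmpty.forall_iff, and_true, if_true, decide_eq_false_iff_not,
      not_lt]
    exact ⟨le_of_lt, fun h1 => lt_of_le_of_ne h1 hne.symm⟩
  · have h' : Odd t := Nat.not_even_iff_odd.mp h
    simp [h, h']

theorem longestAlt_eq_runsFrom {n : ℕ} {w : Fin n → α} (hw : Function.Injective w) :
    longestAlt w = runsFrom true (List.ofFn w) := by
  have hg : IsGreatest {k : ℕ | ∃ g : Fin k → Fin n, StrictMono g ∧ IsAlternating (w ∘ g)}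
      (runsFrom true (List.ofFn w)) := by
    constructor
    · obtain ⟨v, h1, h2, h3⟩ := exists_sublist_stepsAlternate true (List.ofFn w)
      obtain ⟨g, hg⟩ := List.sublist_iff_exists_fin_orderEmbedding_get_eq.mp h1
      rw [← h3]
      refine ⟨fun i => (g i).cast (List.length_ofFn), fun i j hij => g.strictMono hij, ?_⟩
      have hgm : StrictMono fun i => (g i).cast (List.length_ofFn (f := w)) :=
        fun i j hij => g.strictMono hij
      rw [isAlternating_iff (hw.comp hgm.injective)]
      have : List.ofFn (w ∘ fun i => (g i).cast (List.length_ofFn (f := w))) = v := by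
        refine List.ext_getElem (by simp) fun i hi hi' => ?_
        have := hg ⟨i, hi'⟩
        simp at this
        simp [this]
        rfl
      rw [this]
      exact h2
    · rintro k ⟨g, hg, ha⟩
      rw [isAlternating_iff (hw.comp hg.injective)] at ha
      have hs : (List.ofFn (w ∘ g)).Sublist (List.ofFn w) := by
        rw [List.sublist_iff_exists_fin_orderEmbedding_get_eq]
        refine ⟨OrderEmbedding.ofStrictMono
          (fun i => (g (i.cast List.length_ofFn)).cast List.length_ofFn.symm)
          (fun i j hij => hg hij), fun i => ?_⟩
        simp
        rfl
      simpa using length_le_runsFrom (s := true) hs ha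
  exact hg.csSup_eq

end LongestAlternating

/-! ### Alternating runs as blocks of the ascent word -/

section Runs

variable {α : Type*} [LinearOrder α]

theorem length_ascents (l : List α) : (ascents l).length = l.length - 1 := by
  induction l with
  | nil => rfl
  | cons a l ih =>
    rcases l with _ | ⟨b, l⟩
    · rfl
    · simp only [ascents, List.length_cons] at ih ⊢
      omega

theorem ascents_getElem? (l : List α) (k : ℕ) (hk : k + 1 < l.length) :
    (ascents l)[k]? = some (decide (l[k] < l[k + 1])) := by
  induction l generalizing k with
  | nil => simp at hk
  | cons a l ih =>
    rcases l with _ | ⟨b, l⟩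
    · simp at hk
    · rcases k with _ | k
      · simp [ascents]
      · rw [ascents, List.getElem?_cons_succ]
        exact ih k (by simpa using hk)

theorem changes_cons_eq_card (a : Bool) (L : List Bool) :
    changes (a :: L) = ((Finset.range L.length).filter fun i => (a :: L)[i]? ≠ L[i]?).card := by
  induction L generalizing a with
  | nil => simp [changes]
  | cons b L ih =>
    rw [changes, ih, Finset.card_filter, Finset.card_filter, List.length_cons,
      Finset.sum_range_succ', add_comm]
    simp

theorem changes_add_one_eq_card (L : List Bool) :
    (if L = [] then 0 else changes L + 1) =
      ((Finset.range L.length).filter fun i => i = 0 ∨ L[i - 1]? ≠ L[i]?).card := by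
  rcases L with _ | ⟨a, L⟩
  · simp
  · rw [changes_cons_eq_card, Finset.card_filter, Finset.card_filter, List.length_cons,
      Finset.sum_range_succ']
    simp

theorem isMonotoneSegment_iff {n : ℕ} {w : Fin n → α} (hw : Function.Injective w) (i j : Fin n) :
    IsMonotoneSegment w i j ↔ (i : ℕ) < j ∧
      ∃ s, ∀ k : ℕ, (i : ℕ) ≤ k → k < j → (ascents (List.ofFn w))[k]? = some s := by
  have hL : ∀ (k : ℕ) (hk : k + 1 < n), (ascents (List.ofFn w))[k]? =
      some (decide (w ⟨k, Nat.lt_of_succ_lt hk⟩ < w ⟨k + 1, hk⟩)) := by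
    intro k hk
    rw [ascents_getElem? _ k (by simpa using hk)]
    simp
  refine and_congr Iff.rfl ⟨?_, ?_⟩
  · rintro (h | h)
    · refine ⟨true, fun k hik hkj => ?_⟩
      rw [hL k (by omega)]
      simpa using h (a := ⟨k, by omega⟩) (b := ⟨k + 1, by omega⟩)
        ⟨hik, hkj.le⟩ ⟨Nat.le_succ_of_le hik, hkj⟩ (Nat.lt_succ_self k)
    · refine ⟨false, fun k hik hkj => ?_⟩
      rw [hL k (by omega)]
      simpa using (h (a := ⟨k, by omega⟩) (b := ⟨k + 1, by omega⟩)
        ⟨hik, hkj.le⟩ ⟨Nat.le_succ_of_le hik, hkj⟩ (Nat.lt_succ_self k)).le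
  · rintro ⟨s, hs⟩
    -- Consecutive comparisons chain by transitivity; a general r serves both `<` and `>`.
    have key : ∀ (r : α → α → Prop) [IsTrans α r], (∀ (k : ℕ) (hk : k + 1 < n), (i : ℕ) ≤ k →
        k < j → r (w ⟨k, Nat.lt_of_succ_lt hk⟩) (w ⟨k + 1, hk⟩)) →
        ∀ a ∈ Set.Icc i j, ∀ b ∈ Set.Icc i j, a < b → r (w a) (w b) := by
      intro r _ hr a ha b hb hab
      have hr' : ∀ (d : ℕ) (hd : (a : ℕ) + d + 1 ≤ j), r (w a) (w ⟨a + d + 1, by omega⟩) := by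
        intro d
        induction d with
        | zero => exact fun hd => hr a (by omega) ha.1 hd
        | succ d ih =>
          intro hd
          have hia : (i : ℕ) ≤ a := ha.1
          exact _root_.trans (ih (by omega)) (hr (a + d + 1) (by omega) (by omega) (by omega))
      have hab' : (a : ℕ) < b := hab
      have hbj : (b : ℕ) ≤ j := hb.2
      have := hr' (b - a - 1) (by omega)
      have he : (⟨(a : ℕ) + (b - a - 1) + 1, by omega⟩ : Fin n) = b := Fin.ext (by simp; omega)
      rwa [he] at this
    cases s
    · right
      refine fun a ha b hb hab => key (· > ·) (fun k hk hik hkj => ?_) a ha b hb hab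
      have := hs k hik hkj
      rw [hL k hk] at this
      have hle : w ⟨k + 1, hk⟩ ≤ w ⟨k, Nat.lt_of_succ_lt hk⟩ := by simpa using this
      exact lt_of_le_of_ne hle fun h => by simpa using hw h
    · left
      refine fun a ha b hb hab => key (· < ·) (fun k hk hik hkj => ?_) a ha b hb hab
      have := hs k hik hkj
      rw [hL k hk] at this
      simpa using this

/-- A run is determined by its first index, and the first indices are 0 (if there is a step at all)
and the places where the ascent word changes. -/
theorem run_eq_runs {n : ℕ} {w : Fin n → α} (hw : Function.Injective w) :
    run w = runs (List.ofFn w) := by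
  classical
  set L := ascents (List.ofFn w) with hL
  have hlen : L.length = n - 1 := by rw [hL, length_ascents, List.length_ofFn]
  have hM := isMonotoneSegment_iff hw
  rw [← hL] at hM
  rw [runs, ← hL, changes_add_one_eq_card, ← Set.ncard_coe_finset, run,
    ← Set.InjOn.ncard_image (f := fun p : Fin n × Fin n => (p.1 : ℕ))]
  · congr 1
    ext i
    simp only [Set.mem_image, Set.mem_ofPred_eq, Finset.coe_filter, Finset.mem_range, Prod.exists]
    constructor
    · rintro ⟨i, j, ⟨h, hmax⟩, rfl⟩
      obtain ⟨hij, s, hs⟩ := (hM i j).mp h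
      refine ⟨by omega, or_iff_not_imp_left.mpr fun hi heq => ?_⟩
      have := hmax ⟨i - 1, by omega⟩ j (Fin.le_def.mpr (Nat.sub_le _ _)) le_rfl
        ((hM _ _).mpr ⟨by dsimp only; omega, s, fun k hk hkj => ?_⟩)
      · have := congrArg Fin.val this.1
        dsimp only at this
        omega
      · dsimp only at hk
        rcases Nat.lt_or_ge k i with h1 | h1
        · have : k = i - 1 := by omega
          rw [this, heq, hs _ le_rfl hij]
        · exact hs k h1 hkj
    · rintro ⟨hi, hstart⟩
      -- The run starting at i ends at the greatest j with `Q j`. It cannot be extended to the left,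
      -- because the direction changes at i or i = 0.
      set Q : ℕ → Prop := fun j => i < j ∧ ∃ s, ∀ k, i ≤ k → k < j → L[k]? = some s with hQ
      have hQ1 : Q (i + 1) := by
        refine ⟨Nat.lt_succ_self i, L[i], fun k h1 h2 => ?_⟩
        obtain rfl : k = i := by omega
        exact List.getElem?_eq_getElem hi
      have hj1 : Q (Nat.findGreatest Q (n - 1)) := Nat.findGreatest_spec (by omega) hQ1
      have hj2 : Nat.findGreatest Q (n - 1) ≤ n - 1 := Nat.findGreatest_le _
      have hj3 : ∀ j, j ≤ n - 1 → Q j → j ≤ Nat.findGreatest Q (n - 1) :=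
        fun j h1 h2 => Nat.le_findGreatest h1 h2
      generalize Nat.findGreatest Q (n - 1) = j at hj1 hj2 hj3
      refine ⟨⟨i, by omega⟩, ⟨j, by omega⟩, ⟨(hM _ _).mpr hj1, fun i' j' h1 h2 h3 => ?_⟩, rfl⟩
      have h1' : (i' : ℕ) ≤ i := h1
      have h2' : j ≤ (j' : ℕ) := h2
      obtain ⟨h4, s, h5⟩ := (hM _ _).mp h3
      have hi' : (i' : ℕ) = i := by
        by_contra hne
        refine hstart.elim (by omega) fun h => h ?_
        rw [h5 (i - 1) (by omega) (by have := hj1.1; omega), h5 i h1' (by have := hj1.1; omega)]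
      have hj' : (j' : ℕ) ≤ j := hj3 j' (by omega) ⟨hi' ▸ h4, s, hi' ▸ h5⟩
      exact ⟨Fin.ext hi', Fin.ext (le_antisymm hj' h2')⟩
  · rintro ⟨i, j⟩ ⟨h1, h2⟩ ⟨i', j'⟩ ⟨h3, h4⟩ h
    obtain rfl : i = i' := Fin.ext h
    rcases le_total j j' with hj | hj
    · rw [(h2 i j' le_rfl hj h3).2]
    · rw [(h4 i j le_rfl hj h1).2]

end Runs

/-! ### Recurrences for the run polynomials -/

theorem S_eq_fromPoly (n : ℕ) : S n = fromPoly n := by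
  rw [S, Finset.sum_congr rfl fun π _ => by rw [longestAlt_eq_runsFrom π.injective],
    sum_perm_eq_sum_words n fun l => Polynomial.X ^ runsFrom true l, sum_words_runsFrom,
    Finset.card_univ, Fintype.card_fin]

theorem R_succ_eq_binomConv (n : ℕ) : R (n + 1) = binomConv fromPoly fromPoly n := by
  rw [R, Finset.sum_congr rfl fun π _ => by rw [run_eq_runs π.injective],
    sum_perm_eq_sum_words (n + 1) fun l => Polynomial.X ^ runs l,
    sum_words_runs _ (by rw [Finset.card_univ, Fintype.card_fin])]

theorem S_recurrence (m : ℕ) : Polynomial.X * S m +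
    ∑ k ∈ Finset.range (m + 1), (Nat.choose m k : ℤ[X]) * f (m - k) * S (k + 1) = 0 := by
  rw [← f_recurrence_of_binomConv oddPoly_zero evenPoly_zero oddPoly_succ evenPoly_succ
    fromPoly_succ m, S_eq_fromPoly, binomConv]
  simp only [S_eq_fromPoly, mul_right_comm]

theorem R_recurrence (m : ℕ) : 2 * Polynomial.X * R (m + 1) +
    ∑ k ∈ Finset.range (m + 1), (Nat.choose m k : ℤ[X]) * f (m - k) * R (k + 1 + 1) = 0 := by
  rw [← f_recurrence_of_binomConv_sq oddPoly_zero evenPoly_zero oddPoly_succ evenPoly_succ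
    fromPoly_succ R_succ_eq_binomConv m, binomConv]
  simp only [mul_right_comm]

end RunPoly

theorem mainTheorem1 :
    (∀ n : ℕ,
      RunPoly.IsLowerHessenberg
        (RunPoly.hessenbergMatrix (fun i => Polynomial.X * RunPoly.S i) (n + 1)) ∧
      RunPoly.S (n + 1) =
        (RunPoly.hessenbergMatrix (fun i => Polynomial.X * RunPoly.S i) (n + 1)).det) ∧
    (∀ n : ℕ, 1 ≤ n →
      RunPoly.IsLowerHessenberg
        (RunPoly.hessenbergMatrix (fun i => 2 * Polynomial.X * RunPoly.R (i + 1)) n) ∧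
      RunPoly.R (n + 1) =
        (RunPoly.hessenbergMatrix (fun i => 2 * Polynomial.X * RunPoly.R (i + 1)) n).det) := by
  refine ⟨fun n => ⟨RunPoly.hessenbergMatrix_isLowerHessenberg _ _, ?_⟩,
    fun n _ => ⟨RunPoly.hessenbergMatrix_isLowerHessenberg _ _, ?_⟩⟩
  · have h0 : RunPoly.S 0 = 1 := by rw [RunPoly.S_eq_fromPoly, RunPoly.fromPoly_zero]
    exact (RunPoly.det_hessenbergMatrix _ RunPoly.S h0 RunPoly.S_recurrence (n + 1)).symm
  · have h0 : RunPoly.R (0 + 1) = 1 := by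
      rw [RunPoly.R_succ_eq_binomConv]
      simp [RunPoly.binomConv, RunPoly.fromPoly_zero]
    exact (RunPoly.det_hessenbergMatrix _ (fun n => RunPoly.R (n + 1)) h0
      RunPoly.R_recurrence n).symm
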